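/- Let $\mathbb T$ be the unit circle and $\mathbb D$ the closed unit disc in $\mathbb C$. Let $A$ be a finite alphabet, and for each $a\in A$ let $F_a$ be a disc preserving Möbius transformation, i.e. one with $F_a(\mathbb D)=\mathbb D$. For a finite word $v=v_0\cdots v_{n-1}$ put $F_v=F_{v_0}\circ\cdots\circ F_{v_{n-1}}$. Let $A^\omega$ be the set of one-sided infinite words with the product topology; a subshift is a closed subset of $A^\omega$ mapped into itself by the shift $\sigma(w)_i=w_{i+1}$. Write $w_{[0,n)}=w_0\cdots w_{n-1}$. Let $\mu$ be the uniform probability measure on $\mathbb T$. A sequence $(G_n)$ of disc preserving Möbius transformations represents $x\in\mathbb T$ if $G_n\mu\to\delta_x$ in the weak$^*$ topology, i.e. $\int f\,\mathrm d(G_n\mu)\to f(x)$ for every continuous $f:\mathbb T\to\mathbb R$, where $G_n\mu(E)=\mu(G_n^{-1}(E))$. For $w\in A^\omega$ let $\Phi(w)$ be the point represented by $(F_{w_{[0,n)}})_{n\ge 1}$, if there is one, and let $\mathbb X_F\subset A^\omega$ be the domain of $\Phi$. A subshift $\Sigma$ is a Möbius number system for $\{F_a:a\in A\}$ if $\Sigma\subset\mathbb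 X_F$, $\Phi(\Sigma)=\mathbb T$ and $\Phi|_\Sigma$ is continuous. For $a\in A$ let $V_a=\{x\in\mathbb T: |(F_a^{-1})'(x)|>1\}$ be the expansion interval of $F_a^{-1}$. The family $\mathcal V=\{V_a:a\in A\}$ is an interval almost cover of $\mathbb T$ if each $V_a$ is a (possibly empty) union of finitely many open intervals of $\mathbb T$ and $\bigcup_{a\in A}\overline{V_a}=\mathbb T$. For $u\in A^n$ let $W_u=\bigcap_{i=0}^{n-1}F_{u_0\cdots u_{i-1}}(V_{u_i})$ (so $W_u=\mathbb T$ for the empty word), and let $$\Omega=(A^\omega)_{\mathcal V}=\{w\in A^\omega:\ W_{w_{[0,n)}}\ne\emptyset\text{ for all }n\}$$ be the corresponding interval shift. Theorem. If $\mathcal V$ is an interval almost cover of $\mathbb T$, then $\Omega$ is a subshift and a Möbius number system for $\{F_a:a\in A\}$: $\Phi$ is defined and continuous on $\Omega$, and $\Phi(\Omega)=\mathbb T$. -/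

import Mathlib

open Set Filter Topology MeasureTheory
open scoped Pointwise

namespace MobiusNumber

/-! ### Disc preserving Möbius transformations

A Möbius transformation of the Riemann sphere `OnePoint ℂ` is given by an invertible complex
`2 × 2` matrix, acting by `z ↦ (a z + b) / (c z + d)` (Mathlib's action of `GL (Fin 2) ℂ` on
`OnePoint ℂ`); composition corresponds to the product of matrices. -/

/-- The closed unit disc, as a subset of the Riemann sphere. -/
def closedDisc : Set (OnePoint ℂ) :=
  (fun z : ℂ => (z : OnePoint ℂ)) '' Metric.closedBall 0 1

/-- The disc preserving Möbius transformations: the `g` with `g(𝔻) = 𝔻`. -/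
noncomputable def discMobius : Subgroup (GL (Fin 2) ℂ) :=
  MulAction.stabilizer (GL (Fin 2) ℂ) closedDisc

/-- The formula `z ↦ (a z + b) / (c z + d)` on the finite plane. -/
noncomputable def mobiusFun (g : GL (Fin 2) ℂ) (z : ℂ) : ℂ :=
  (g 0 0 * z + g 0 1) / (g 1 0 * z + g 1 1)

theorem coe_mem_closedDisc {z : ℂ} : (z : OnePoint ℂ) ∈ closedDisc ↔ ‖z‖ ≤ 1 := by
  constructor
  · rintro ⟨w, hw, h⟩
    have hwz : w = z := OnePoint.coe_injective h
    simpa [hwz] using hw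
  · intro h
    exact ⟨z, by simpa using h, rfl⟩

theorem smul_mem_closedDisc_iff {g : GL (Fin 2) ℂ} (hg : g ∈ discMobius) (x : OnePoint ℂ) :
    g • x ∈ closedDisc ↔ x ∈ closedDisc := by
  have h : g • closedDisc = closedDisc := hg
  conv_lhs => rw [← h]
  exact Set.smul_mem_smul_set_iff

/-- A disc preserving transformation has no pole in the closed disc. -/
theorem denom_ne_zero {g : GL (Fin 2) ℂ} (hg : g ∈ discMobius) {z : ℂ} (hz : ‖z‖ ≤ 1) :
    g 1 0 * z + g 1 1 ≠ 0 := by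
  intro h0
  have h := (smul_mem_closedDisc_iff hg z).2 (coe_mem_closedDisc.2 hz)
  rw [OnePoint.smul_some_eq_ite, if_pos h0] at h
  obtain ⟨w, -, hw⟩ := h
  exact OnePoint.coe_ne_infty w hw

theorem smul_coe_eq {g : GL (Fin 2) ℂ} {z : ℂ} (h : g 1 0 * z + g 1 1 ≠ 0) :
    g • (z : OnePoint ℂ) = (mobiusFun g z : ℂ) := by
  rw [OnePoint.smul_some_eq_ite, if_neg h, mobiusFun]

/-- Disc preserving transformations preserve the unit circle. -/
theorem norm_mobiusFun {g : GL (Fin 2) ℂ} (hg : g ∈ discMobius) {z : ℂ} (hz : ‖z‖ = 1) :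
    ‖mobiusFun g z‖ = 1 := by
  have hd := denom_ne_zero hg hz.le
  have hle : ‖mobiusFun g z‖ ≤ 1 := by
    rw [← coe_mem_closedDisc, ← smul_coe_eq hd, smul_mem_closedDisc_iff hg, coe_mem_closedDisc]
    exact hz.le
  by_contra hne
  have hlt : ‖mobiusFun g z‖ < 1 := lt_of_le_of_ne hle hne
  have hcd : ContinuousAt (fun w : ℂ => g 1 0 * w + g 1 1) z := by fun_prop
  have hcn : ContinuousAt (fun w : ℂ => g 0 0 * w + g 0 1) z := by fun_prop
  have hc : ContinuousAt (mobiusFun g) z := hcn.div hcd hd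
  have hev : ∀ᶠ w in 𝓝 z, ‖mobiusFun g w‖ < 1 ∧ g 1 0 * w + g 1 1 ≠ 0 :=
    (hc.norm.eventually (gt_mem_nhds hlt)).and (hcd.eventually_ne hd)
  have hray : Tendsto (fun t : ℝ => (1 + (t : ℂ)) * z) (𝓝[>] 0) (𝓝 z) := by
    have h : ContinuousAt (fun t : ℝ => (1 + (t : ℂ)) * z) 0 := by fun_prop
    have h' := h.tendsto
    simp only [Complex.ofReal_zero, add_zero, one_mul] at h'
    exact h'.mono_left nhdsWithin_le_nhds
  obtain ⟨t, ⟨h1, h2⟩, ht⟩ := ((hray.eventually hev).and self_mem_nhdsWithin).exists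
  have h3 : ‖(1 + (t : ℂ)) * z‖ ≤ 1 := by
    rw [← coe_mem_closedDisc, ← smul_mem_closedDisc_iff hg, smul_coe_eq h2, coe_mem_closedDisc]
    exact h1.le
  have h4 : ‖(1 + (t : ℂ))‖ = 1 + t := by
    have h5 : (1 + (t : ℂ)) = ((1 + t : ℝ) : ℂ) := by push_cast; rfl
    rw [h5, Complex.norm_real, Real.norm_of_nonneg]
    have : (0 : ℝ) < t := ht
    linarith
  rw [norm_mul, hz, h4] at h3
  have : (0 : ℝ) < t := ht
  linarith

/-- The map `𝕋 → 𝕋` induced by a disc preserving Möbius transformation. -/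
noncomputable def circleMap (g : discMobius) (z : Circle) : Circle :=
  ⟨mobiusFun g z, mem_sphere_zero_iff_norm.2 (norm_mobiusFun g.2 z.norm_coe)⟩

/-- `circleMap g` is the restriction to the circle of the action of `g` on the sphere. -/
theorem coe_circleMap (g : discMobius) (z : Circle) :
    (((circleMap g z : Circle) : ℂ) : OnePoint ℂ) = (g : GL (Fin 2) ℂ) • ((z : ℂ) : OnePoint ℂ) :=
  (smul_coe_eq (denom_ne_zero g.2 z.norm_coe.le)).symm

/-- The modulus of the derivative of `g` at a point `x` of the circle. -/
noncomputable def derivModulus (g : discMobius) (x : Circle) : ℝ :=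
  ‖deriv (mobiusFun g) (x : ℂ)‖

/-- The points of the circle near which `g` expands. -/
def expansionInterval (g : discMobius) : Set Circle :=
  {x | 1 < derivModulus g x}

/-! ### Representing points -/

noncomputable instance : MeasurableSpace Circle := borel Circle

instance : BorelSpace Circle := ⟨rfl⟩

/-- The uniform probability measure on the circle (normalized arc length). -/
noncomputable def uniformMeasure : Measure Circle :=
  (ENNReal.ofReal (2 * Real.pi)⁻¹ • volume.restrict (Ioc (-Real.pi) Real.pi)).map Circle.exp

instance : IsProbabilityMeasure uniformMeasure := by
  constructor
  have hpi := Real.pi_pos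
  rw [uniformMeasure, Measure.map_apply Circle.exp.continuous.measurable MeasurableSet.univ]
  simp only [preimage_univ, Measure.smul_apply, Measure.restrict_apply_univ, Real.volume_Ioc,
    smul_eq_mul]
  rw [← ENNReal.ofReal_mul (by positivity), ← ENNReal.ofReal_one]
  congr 1
  field_simp
  ring

/-- The sequence `G` of Möbius transformations represents the point `x` if the images of the
uniform measure under `G n` converge weak* to the Dirac measure at `x`. -/
def Represents (G : ℕ → discMobius) (x : Circle) : Prop :=
  ∀ f : Circle → ℝ, Continuous f →
    Tendsto (fun n => ∫ z, f z ∂(uniformMeasure.map (circleMap (G n)))) atTop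
      (𝓝 (∫ z, f z ∂(Measure.dirac x)))

/-- A sequence represents at most one point. -/
theorem Represents.unique {G : ℕ → discMobius} {x y : Circle} (hx : Represents G x)
    (hy : Represents G y) : x = y := by
  have hf : Continuous fun z : Circle => dist z y := by fun_prop
  have h := tendsto_nhds_unique (hx _ hf) (hy _ hf)
  rw [integral_dirac, integral_dirac, dist_self] at h
  exact dist_eq_zero.1 h

/-! ### Words, subshifts and Möbius number systems

Finite words are lists, infinite words are functions `ℕ → A`. -/

variable {A : Type*}

/-- The prefix `w_0 w_1 ⋯ w_{n-1}` of an infinite word. -/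
def wordPrefix (w : ℕ → A) (n : ℕ) : List A :=
  List.ofFn fun i : Fin n => w i

/-- `F_v = F_{v_0} ∘ F_{v_1} ∘ ⋯ ∘ F_{v_{n-1}}`. -/
noncomputable def wordMap (F : A → discMobius) (v : List A) : discMobius :=
  (v.map F).prod

/-- The words `w` for which the maps of the prefixes of `w` represent some point. -/
def domain (F : A → discMobius) : Set (ℕ → A) :=
  {w | ∃ x, Represents (fun n => wordMap F (wordPrefix w n)) x}

open Classical in
/-- `Φ(w)` is the point represented by the maps of the prefixes of `w`; the value outside
`domain F` is irrelevant. -/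
noncomputable def Phi (F : A → discMobius) (w : ℕ → A) : Circle :=
  if h : w ∈ domain F then Exists.choose h else 1

theorem Phi_eq {F : A → discMobius} {w : ℕ → A} {x : Circle}
    (h : Represents (fun n => wordMap F (wordPrefix w n)) x) : Phi F w = x := by
  have hw : w ∈ domain F := ⟨x, h⟩
  rw [Phi, dif_pos hw]
  exact (Exists.choose_spec hw).unique h

/-- A subshift: a closed set of infinite words that the shift map sends into itself. -/
def IsSubshift [TopologicalSpace A] (S : Set (ℕ → A)) : Prop :=
  IsClosed S ∧ ∀ w ∈ S, (fun i => w (i + 1)) ∈ S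

/-- The set `S` is a Möbius number system for the iterative system `F`. -/
structure IsMobiusNumberSystem [TopologicalSpace A] (F : A → discMobius) (S : Set (ℕ → A)) :
    Prop where
  isSubshift : IsSubshift S
  subset_domain : S ⊆ domain F
  image_eq : Phi F '' S = univ
  continuousOn : ContinuousOn (Phi F) S

/-! ### Interval almost covers and interval shifts -/

/-- An open interval `(x, y)`, `x ≠ y`, on the circle. -/
def IsOpenInterval (I : Set Circle) : Prop :=
  ∃ s t : ℝ, s < t ∧ t < s + 2 * Real.pi ∧ I = Circle.exp '' Ioo s t

/-- The closures of the sets `W a` cover the circle, and each `W a` is a finite (possibly empty)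
union of open intervals. -/
structure IsIntervalAlmostCover (W : A → Set Circle) : Prop where
  iUnion_closure : ⋃ a, closure (W a) = univ
  finite_union : ∀ a, ∃ J : Set (Set Circle), J.Finite ∧ (∀ I ∈ J, IsOpenInterval I) ∧ W a = ⋃₀ J

/-- The refined set `W_u = W_{u_0} ∩ F_{u_0}(W_{u_1}) ∩ ⋯ ∩ F_{u_0 ⋯ u_{n-2}}(W_{u_{n-1}})`,
which is the whole circle for the empty word. -/
def refinedSet (F : A → discMobius) (W : A → Set Circle) (u : List A) : Set Circle :=
  ⋂ i : Fin u.length, circleMap (wordMap F (u.take i)) '' W (u.get i)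

/-- The interval shift `S_W`: the words of `S` all of whose prefixes have a nonempty refined
set. -/
def intervalShift (F : A → discMobius) (W : A → Set Circle) (S : Set (ℕ → A)) : Set (ℕ → A) :=
  {w ∈ S | ∀ n, (refinedSet F W (wordPrefix w n)).Nonempty}

end MobiusNumber

/-! Write G_n for the map of the n-th prefix of w and c_n = G_n(0). Since ∫ G_n dμ = c_n, the mean
square distance from G_n to x is 2 - 2 Re(x̄ c_n), so c_n → x already implies that (G_n) represents
x (`represents_of_tendsto_center`).

The core is `tendsto_center_of_mem_closure_refinedSet`: if x lies in the closure of every refined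
set, then c_n → x. By the chain rule p_n = |(G_n⁻¹)'(x)| is nondecreasing, and it equals the Poisson
kernel (1 - |c_n|²)/|x - c_n|². If p_n is unbounded, then c_n → x at once. If it is bounded, its
successive ratios tend to 1, and finiteness of the alphabet forces them to be eventually equal to 1
(`eventually_derivModulus_eq_one`), so the c_n end up on one horocycle at x. In the half-plane with
x at infinity this is a vertical line, on which they move by steps bounded below. A reversal of
direction would keep a refined set away from x, so they run off to infinity, that is, to x.

Thus the closures of the refined sets along a word meet in the single point Φ(w), and compactness
gives existence and continuity. Surjectivity comes from extending a prefix letter by letter with x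
kept in the closure (`exists_mem_closure_append`). -/

namespace MobiusNumber

/-! ### Conformal dilation of disc preserving transformations -/

/-- The modulus of the derivative of `g` at a point `z` of the closed disc. -/
noncomputable def dilation (g : discMobius) (z : ℂ) : ℝ :=
  ‖(g : GL (Fin 2) ℂ).val.det‖ / ‖(g : GL (Fin 2) ℂ) 1 0 * z + (g : GL (Fin 2) ℂ) 1 1‖ ^ 2

theorem norm_mobiusFun_le (g : discMobius) {z : ℂ} (hz : ‖z‖ ≤ 1) : ‖mobiusFun g z‖ ≤ 1 := by
  rw [← coe_mem_closedDisc, ← smul_coe_eq (denom_ne_zero g.2 hz), smul_mem_closedDisc_iff g.2,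
    coe_mem_closedDisc]
  exact hz

theorem mobiusFun_mul (g h : discMobius) {z : ℂ} (hz : ‖z‖ ≤ 1) :
    mobiusFun (g * h : discMobius) z = mobiusFun g (mobiusFun h z) := by
  apply OnePoint.coe_injective
  rw [← smul_coe_eq (denom_ne_zero (g * h).2 hz),
    ← smul_coe_eq (denom_ne_zero g.2 (norm_mobiusFun_le h hz)),
    ← smul_coe_eq (denom_ne_zero h.2 hz), Subgroup.coe_mul, mul_smul]

@[simp] theorem mobiusFun_one (z : ℂ) : mobiusFun (1 : discMobius) z = z := by
  simp [mobiusFun]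

theorem det_ne_zero (g : discMobius) : (g : GL (Fin 2) ℂ).val.det ≠ 0 :=
  ((Matrix.isUnit_iff_isUnit_det _).1 (g : GL (Fin 2) ℂ).isUnit).ne_zero

theorem dilation_pos (g : discMobius) {z : ℂ} (hz : ‖z‖ ≤ 1) : 0 < dilation g z :=
  div_pos (norm_pos_iff.2 (det_ne_zero g)) (pow_pos (norm_pos_iff.2 (denom_ne_zero g.2 hz)) 2)

theorem mobiusFun_sub (g : discMobius) {z w : ℂ} (hz : ‖z‖ ≤ 1) (hw : ‖w‖ ≤ 1) :
    mobiusFun g z - mobiusFun g w = (g : GL (Fin 2) ℂ).val.det * (z - w) /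
      (((g : GL (Fin 2) ℂ) 1 0 * z + (g : GL (Fin 2) ℂ) 1 1) *
        ((g : GL (Fin 2) ℂ) 1 0 * w + (g : GL (Fin 2) ℂ) 1 1)) := by
  rw [mobiusFun, mobiusFun, div_sub_div _ _ (denom_ne_zero g.2 hz) (denom_ne_zero g.2 hw),
    Matrix.det_fin_two]
  congr 1
  ring

/-- The difference of two values has one denominator from each point, so the distortion splits
exactly. Every metric identity below rests on this. -/
theorem sq_norm_mobiusFun_sub (g : discMobius) {z w : ℂ} (hz : ‖z‖ ≤ 1) (hw : ‖w‖ ≤ 1) :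
    ‖mobiusFun g z - mobiusFun g w‖ ^ 2 = dilation g z * dilation g w * ‖z - w‖ ^ 2 := by
  rw [mobiusFun_sub g hz hw, dilation, dilation, norm_div, norm_mul, norm_mul]
  have h1 := norm_ne_zero_iff.2 (denom_ne_zero g.2 hz)
  have h2 := norm_ne_zero_iff.2 (denom_ne_zero g.2 hw)
  field_simp

/-- Preservation of the circle, tested at ±1 and ±i, gives |a|² + |b|² = |c|² + |d|² and a b̄ = c d̄
for the matrix entries, which is all the identity needs. -/
theorem one_sub_sq_norm_mobiusFun (g : discMobius) {z : ℂ} (hz : ‖z‖ ≤ 1) :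
    1 - ‖mobiusFun g z‖ ^ 2 = dilation g z * (1 - ‖z‖ ^ 2) := by
  have hcirc : ∀ u : ℂ, ‖u‖ = 1 →
      Complex.normSq ((g : GL (Fin 2) ℂ) 0 0 * u + (g : GL (Fin 2) ℂ) 0 1) =
        Complex.normSq ((g : GL (Fin 2) ℂ) 1 0 * u + (g : GL (Fin 2) ℂ) 1 1) := by
    intro u hu
    have h := norm_mobiusFun g.2 hu
    rw [mobiusFun, norm_div, div_eq_one_iff_eq (norm_ne_zero_iff.2 (denom_ne_zero g.2 hu.le))] at h
    rw [Complex.normSq_eq_norm_sq, Complex.normSq_eq_norm_sq, h]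
  have hd := norm_ne_zero_iff.2 (denom_ne_zero g.2 hz)
  have h0 : Complex.normSq ((g : GL (Fin 2) ℂ) 0 1) ≤ Complex.normSq ((g : GL (Fin 2) ℂ) 1 1) := by
    have hd0 := denom_ne_zero g.2 (z := 0) (by simp)
    have h := norm_mobiusFun_le g (z := 0) (by simp)
    simp only [mobiusFun, mul_zero, zero_add] at h hd0
    rw [norm_div, div_le_one (norm_pos_iff.2 hd0)] at h
    rw [Complex.normSq_eq_norm_sq, Complex.normSq_eq_norm_sq]
    gcongr
  have e1 := hcirc 1 (by simp)
  have e2 := hcirc (-1) (by simp)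
  have e3 := hcirc Complex.I (by simp)
  have e4 := hcirc (-Complex.I) (by simp)
  have key : ∀ a b c d z : ℂ, Complex.normSq b ≤ Complex.normSq d →
      Complex.normSq (a * 1 + b) = Complex.normSq (c * 1 + d) →
      Complex.normSq (a * -1 + b) = Complex.normSq (c * -1 + d) →
      Complex.normSq (a * Complex.I + b) = Complex.normSq (c * Complex.I + d) →
      Complex.normSq (a * -Complex.I + b) = Complex.normSq (c * -Complex.I + d) →
      Complex.normSq (c * z + d) - Complex.normSq (a * z + b) =
        ‖a * d - b * c‖ * (1 - Complex.normSq z) := by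
    intro a b c d z h0 e1 e2 e3 e4
    have hf : a.re ^ 2 + a.im ^ 2 + b.re ^ 2 + b.im ^ 2 =
          c.re ^ 2 + c.im ^ 2 + d.re ^ 2 + d.im ^ 2 ∧
        a.re * b.re + a.im * b.im = c.re * d.re + c.im * d.im ∧
        a.im * b.re - a.re * b.im = c.im * d.re - c.re * d.im := by
      simp only [Complex.normSq_apply, Complex.add_re, Complex.add_im, Complex.mul_re,
        Complex.mul_im, Complex.neg_re, Complex.neg_im, Complex.I_re, Complex.I_im,
        Complex.one_re, Complex.one_im] at e1 e2 e3 e4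
      exact ⟨by linarith, by linarith, by linarith⟩
    obtain ⟨f1, f2, f3⟩ := hf
    -- The relations give only the squared equality; `h0`, which says that 0 stays in the disc,
    -- fixes the sign.
    have hK : ‖a * d - b * c‖ = Complex.normSq d - Complex.normSq b := by
      rw [← abs_of_nonneg (norm_nonneg _), ← abs_of_nonneg (sub_nonneg.2 h0),
        ← sq_eq_sq_iff_abs_eq_abs, ← Complex.normSq_eq_norm_sq]
      simp only [Complex.normSq_apply, Complex.sub_re, Complex.sub_im, Complex.mul_re,
        Complex.mul_im]
      linear_combination (d.re ^ 2 + d.im ^ 2 - b.re ^ 2 - b.im ^ 2) * f1 +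
        (a.re * b.re + a.im * b.im - c.re * d.re - c.im * d.im) * f2 +
        (a.im * b.re - a.re * b.im - c.im * d.re + c.re * d.im) * f3
    rw [hK]
    simp only [Complex.normSq_apply, Complex.add_re, Complex.add_im, Complex.mul_re,
      Complex.mul_im]
    linear_combination (-(z.re ^ 2 + z.im ^ 2)) * f1 - 2 * z.re * f2 + 2 * z.im * f3
  have hk := key _ _ _ _ z h0 e1 e2 e3 e4
  rw [Complex.normSq_eq_norm_sq, Complex.normSq_eq_norm_sq, Complex.normSq_eq_norm_sq] at hk
  rw [mobiusFun, dilation, Matrix.det_fin_two, norm_div, div_pow, one_sub_div (pow_ne_zero 2 hd),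
    div_mul_eq_mul_div, hk]

theorem dilation_mul (g h : discMobius) {z : ℂ} (hz : ‖z‖ ≤ 1) :
    dilation (g * h) z = dilation g (mobiusFun h z) * dilation h z := by
  have hd := denom_ne_zero h.2 hz
  have e : ((g * h : discMobius) : GL (Fin 2) ℂ) 1 0 * z + ((g * h : discMobius) : GL (Fin 2) ℂ) 1 1
      = ((g : GL (Fin 2) ℂ) 1 0 * mobiusFun h z + (g : GL (Fin 2) ℂ) 1 1) *
        ((h : GL (Fin 2) ℂ) 1 0 * z + (h : GL (Fin 2) ℂ) 1 1) := by
    simp only [mobiusFun, Subgroup.coe_mul, Units.val_mul, Matrix.mul_apply, Fin.sum_univ_two]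
    field_simp
    ring
  rw [dilation, dilation, dilation, e, norm_mul, mul_pow, div_mul_div_comm, ← norm_mul,
    Subgroup.coe_mul, Units.val_mul, Matrix.det_mul]

theorem dilation_one (z : ℂ) : dilation 1 z = 1 := by
  simp [dilation]

theorem hasDerivAt_mobiusFun (g : discMobius) {z : ℂ} (hz : ‖z‖ ≤ 1) :
    HasDerivAt (mobiusFun g) ((g : GL (Fin 2) ℂ).val.det /
      ((g : GL (Fin 2) ℂ) 1 0 * z + (g : GL (Fin 2) ℂ) 1 1) ^ 2) z := by
  have h1 : HasDerivAt (fun w : ℂ => (g : GL (Fin 2) ℂ) 0 0 * w + (g : GL (Fin 2) ℂ) 0 1)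
      ((g : GL (Fin 2) ℂ) 0 0) z := by
    simpa using ((hasDerivAt_id z).const_mul ((g : GL (Fin 2) ℂ) 0 0)).add_const
      ((g : GL (Fin 2) ℂ) 0 1)
  have h2 : HasDerivAt (fun w : ℂ => (g : GL (Fin 2) ℂ) 1 0 * w + (g : GL (Fin 2) ℂ) 1 1)
      ((g : GL (Fin 2) ℂ) 1 0) z := by
    simpa using ((hasDerivAt_id z).const_mul ((g : GL (Fin 2) ℂ) 1 0)).add_const
      ((g : GL (Fin 2) ℂ) 1 1)
  refine (h1.div h2 (denom_ne_zero g.2 hz)).congr_deriv ?_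
  rw [Matrix.det_fin_two]
  ring

theorem derivModulus_eq_dilation (g : discMobius) (x : Circle) :
    derivModulus g x = dilation g x := by
  rw [derivModulus, (hasDerivAt_mobiusFun g x.norm_coe.le).deriv, norm_div, norm_pow, dilation]

/-! ### The action on the circle -/

theorem coe_circleMap_eq (g : discMobius) (x : Circle) :
    ((circleMap g x : Circle) : ℂ) = mobiusFun g x := rfl

theorem circleMap_mul (g h : discMobius) (x : Circle) :
    circleMap (g * h) x = circleMap g (circleMap h x) :=
  Circle.ext (mobiusFun_mul g h x.norm_coe.le)

@[simp] theorem circleMap_one (x : Circle) : circleMap 1 x = x :=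
  Circle.ext (mobiusFun_one x)

@[simp] theorem circleMap_inv_apply (g : discMobius) (x : Circle) :
    circleMap g⁻¹ (circleMap g x) = x := by
  rw [← circleMap_mul, inv_mul_cancel, circleMap_one]

@[simp] theorem circleMap_apply_inv (g : discMobius) (x : Circle) :
    circleMap g (circleMap g⁻¹ x) = x := by
  rw [← circleMap_mul, mul_inv_cancel, circleMap_one]

theorem image_circleMap (g : discMobius) (S : Set Circle) :
    circleMap g '' S = circleMap g⁻¹ ⁻¹' S :=
  congrFun (image_eq_preimage_of_inverse (circleMap_inv_apply g) (circleMap_apply_inv g)) S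

theorem continuous_circleMap (g : discMobius) : Continuous (circleMap g) := by
  refine Continuous.subtype_mk ?_ _
  exact continuous_iff_continuousAt.2 fun x =>
    (hasDerivAt_mobiusFun g x.norm_coe.le).continuousAt.comp
      continuous_subtype_val.continuousAt

theorem continuous_derivModulus (g : discMobius) : Continuous (derivModulus g) := by
  have h : derivModulus g = fun x : Circle => dilation g x :=
    funext (derivModulus_eq_dilation g)
  rw [h]
  unfold dilation
  refine Continuous.div continuous_const (by fun_prop) fun x => ?_
  exact pow_ne_zero 2 (norm_ne_zero_iff.2 (denom_ne_zero g.2 x.norm_coe.le))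

theorem isOpen_expansionInterval (g : discMobius) : IsOpen (expansionInterval g) :=
  isOpen_lt continuous_const (continuous_derivModulus g)

theorem derivModulus_pos (g : discMobius) (x : Circle) : 0 < derivModulus g x :=
  derivModulus_eq_dilation g x ▸ dilation_pos g x.norm_coe.le

theorem derivModulus_mul (g h : discMobius) (x : Circle) :
    derivModulus (g * h) x = derivModulus g (circleMap h x) * derivModulus h x := by
  simp only [derivModulus_eq_dilation, coe_circleMap_eq]
  exact dilation_mul g h x.norm_coe.le

@[simp] theorem derivModulus_one (x : Circle) : derivModulus 1 x = 1 := by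
  rw [derivModulus_eq_dilation, dilation_one]

theorem circle_dist_eq_norm (x y : Circle) : dist x y = ‖(x : ℂ) - y‖ :=
  dist_eq_norm (x : ℂ) y

theorem sq_dist_circleMap (g : discMobius) (x y : Circle) :
    dist (circleMap g x) (circleMap g y) ^ 2 =
      derivModulus g x * derivModulus g y * dist x y ^ 2 := by
  rw [circle_dist_eq_norm, circle_dist_eq_norm, derivModulus_eq_dilation,
    derivModulus_eq_dilation]
  exact sq_norm_mobiusFun_sub g x.norm_coe.le y.norm_coe.le

/-! ### The centre of a transformation and the Poisson kernel -/

/-- The image of the centre of the disc. -/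
noncomputable def center (g : discMobius) : ℂ := mobiusFun g 0

theorem dilation_zero (g : discMobius) : dilation g 0 = 1 - ‖center g‖ ^ 2 := by
  simpa [center] using (one_sub_sq_norm_mobiusFun g (z := 0) (by simp)).symm

theorem one_sub_sq_norm_center_pos (g : discMobius) : 0 < 1 - ‖center g‖ ^ 2 :=
  dilation_zero g ▸ dilation_pos g (by simp)

theorem norm_center_lt_one (g : discMobius) : ‖center g‖ < 1 := by
  have h := one_sub_sq_norm_center_pos g
  have h0 := norm_nonneg (center g)
  nlinarith

theorem coe_sub_center_ne_zero (g : discMobius) (x : Circle) : (x : ℂ) - center g ≠ 0 := by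
  intro h
  have h1 := norm_center_lt_one g
  rw [← sub_eq_zero.1 h, Circle.norm_coe] at h1
  exact lt_irrefl _ h1

/-- The dilation of `g⁻¹` on the circle is the Poisson kernel of the centre of `g`. -/
theorem derivModulus_inv_mul (g : discMobius) (x : Circle) :
    derivModulus g⁻¹ x * ‖(x : ℂ) - center g‖ ^ 2 = 1 - ‖center g‖ ^ 2 := by
  -- The pair g⁻¹(x), 0 is sent to x and the centre; the chain rule then inverts the dilation at
  -- g⁻¹(x).
  have h := sq_norm_mobiusFun_sub g (z := (circleMap g⁻¹ x : Circle)) (w := 0)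
    (Circle.norm_coe _).le (by simp)
  rw [← coe_circleMap_eq, circleMap_apply_inv, sub_zero, Circle.norm_coe, dilation_zero,
    ← derivModulus_eq_dilation] at h
  have h2 := derivModulus_mul g g⁻¹ x
  rw [mul_inv_cancel, derivModulus_one] at h2
  change ‖(x : ℂ) - center g‖ ^ 2 = _ at h
  rw [h]
  linear_combination (-(1 - ‖center g‖ ^ 2)) * h2

/-- Invariance of hyperbolic distance: the centres of g h and g are as far apart as h(0) and 0. -/
theorem sq_norm_center_mul_sub (g h : discMobius) :
    ‖center (g * h) - center g‖ ^ 2 * (1 - ‖center h‖ ^ 2) =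
      (1 - ‖center (g * h)‖ ^ 2) * (1 - ‖center g‖ ^ 2) * ‖center h‖ ^ 2 := by
  have hh := (norm_center_lt_one h).le
  have e : center (g * h) = mobiusFun g (center h) := mobiusFun_mul g h (by simp)
  have h1 := sq_norm_mobiusFun_sub g (w := 0) hh (by simp)
  have h2 := one_sub_sq_norm_mobiusFun g hh
  rw [← e] at h1 h2
  change ‖center (g * h) - center g‖ ^ 2 = _ at h1
  rw [h2, h1, sub_zero, ← dilation_zero g]
  ring

theorem tendsto_center_of_derivModulus_atTop {G : ℕ → discMobius} {x : Circle}
    (h : Tendsto (fun n => derivModulus (G n)⁻¹ x) atTop atTop) :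
    Tendsto (fun n => center (G n)) atTop (𝓝 (x : ℂ)) := by
  rw [tendsto_iff_norm_sub_tendsto_zero]
  have h1 : Tendsto (fun n => ‖center (G n) - x‖ ^ 2) atTop (𝓝 0) := by
    refine squeeze_zero (fun _ => by positivity) (fun n => ?_) (tendsto_inv_atTop_zero.comp h)
    have hp := derivModulus_inv_mul (G n) x
    have hpos := derivModulus_pos (G n)⁻¹ x
    rw [Function.comp_apply, norm_sub_rev, ← one_div, le_div_iff₀ hpos]
    nlinarith [sq_nonneg ‖center (G n)‖]
  have h2 := h1.sqrt
  simpa [Real.sqrt_sq (norm_nonneg _)] using h2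

/-- The Poisson kernel of the centre 0 is constantly 1, so nothing is expanded. -/
theorem center_ne_zero_of_nonempty {g : discMobius} (h : (expansionInterval g⁻¹).Nonempty) :
    center g ≠ 0 := by
  obtain ⟨x, hx⟩ := h
  intro h0
  have h1 := derivModulus_inv_mul g x
  rw [h0] at h1
  simp only [sub_zero, Circle.norm_coe, norm_zero] at h1
  have : 1 < derivModulus g⁻¹ x := hx
  linarith

/-- On the circle x̄ = 1/x turns |x - c|² = 1 - |c|² into c̄x² - 2|c|²x + c = 0, a nonzero
polynomial equation when c ≠ 0. -/
theorem finite_derivModulus_eq_one {g : discMobius} (h : center g ≠ 0) :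
    {x : Circle | derivModulus g⁻¹ x = 1}.Finite := by
  set c := center g
  let p : Polynomial ℂ := Polynomial.C (starRingEnd ℂ c) * Polynomial.X ^ 2 +
    Polynomial.C (-2 * c * starRingEnd ℂ c) * Polynomial.X + Polynomial.C c
  have hp : p ≠ 0 := by
    intro h0
    have := congrArg (Polynomial.eval 0) h0
    simp [p] at this
    exact h this
  refine Set.Finite.of_finite_image (f := fun x : Circle => (x : ℂ)) ?_
    Circle.coe_injective.injOn
  refine (p.rootSet_finite ℂ).subset ?_
  rintro _ ⟨x, hx, rfl⟩
  rw [Polynomial.mem_rootSet]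
  refine ⟨hp, ?_⟩
  have h1 := derivModulus_inv_mul g x
  have hx1 : derivModulus g⁻¹ x = 1 := hx
  have hxx : (x : ℂ) * starRingEnd ℂ (x : ℂ) = 1 := by
    rw [Complex.mul_conj, Complex.normSq_eq_norm_sq, Circle.norm_coe]; simp
  rw [hx1, one_mul] at h1
  have h2 : ((x : ℂ) - c) * starRingEnd ℂ ((x : ℂ) - c) = 1 - c * starRingEnd ℂ c := by
    rw [Complex.mul_conj, Complex.mul_conj, Complex.normSq_eq_norm_sq, Complex.normSq_eq_norm_sq,
      h1]
    push_cast; rfl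
  rw [map_sub] at h2
  simp only [p, map_add, map_mul, Polynomial.aeval_C, Polynomial.aeval_X, map_pow,
    Algebra.algebraMap_self, RingHom.id_apply]
  linear_combination (-(x : ℂ)) * h2 + (x - c) * hxx

/-! ### Representation of points by convergence of centres -/

theorem integral_uniformMeasure {E : Type*} [NormedAddCommGroup E] [NormedSpace ℝ E]
    {f : Circle → E} (hf : Continuous f) :
    ∫ z, f z ∂uniformMeasure = (2 * Real.pi)⁻¹ • ∫ t in -Real.pi..Real.pi, f (Circle.exp t) := by
  have hpi := Real.pi_pos
  rw [uniformMeasure, integral_map Circle.exp.continuous.measurable.aemeasurable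
    hf.aestronglyMeasurable_of_compactSpace, integral_smul_measure,
    intervalIntegral.integral_of_le (by linarith), ENNReal.toReal_ofReal (by positivity)]

/-- Mean value property of the holomorphic map g on the disc. -/
theorem integral_coe_circleMap (g : discMobius) :
    ∫ z, ((circleMap g z : Circle) : ℂ) ∂uniformMeasure = center g := by
  have hd : DiffContOnCl ℂ (mobiusFun g) (Metric.ball 0 |1|) := by
    refine DifferentiableOn.diffContOnCl fun z hz => ?_
    rw [abs_one, closure_ball _ one_ne_zero, mem_closedBall_zero_iff] at hz
    exact (hasDerivAt_mobiusFun g hz).differentiableAt.differentiableWithinAt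
  have h := hd.circleAverage
  have hc : Continuous fun z => ((circleMap g z : Circle) : ℂ) :=
    continuous_subtype_val.comp (continuous_circleMap g)
  rw [integral_uniformMeasure hc, center, ← h, Real.circleAverage]
  have hper : Function.Periodic (fun t => mobiusFun g (_root_.circleMap 0 1 t)) (2 * Real.pi) :=
    fun t => by simp only [periodic_circleMap 0 1 t]
  have h2 := hper.intervalIntegral_add_eq (-Real.pi) 0
  rw [zero_add, show -Real.pi + 2 * Real.pi = Real.pi by ring] at h2
  rw [← h2]
  simp [_root_.circleMap, coe_circleMap_eq, Circle.coe_exp]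

theorem integral_sq_dist_circleMap (g : discMobius) (x : Circle) :
    ∫ z, dist (circleMap g z) x ^ 2 ∂uniformMeasure =
      2 - 2 * (starRingEnd ℂ (x : ℂ) * center g).re := by
  have hc : Continuous fun z => ((circleMap g z : Circle) : ℂ) :=
    continuous_subtype_val.comp (continuous_circleMap g)
  have hi : Integrable (fun z => ((circleMap g z : Circle) : ℂ)) uniformMeasure :=
    hc.integrable_of_hasCompactSupport (HasCompactSupport.of_compactSpace _)
  have h1 : ∀ z : Circle, dist (circleMap g z) x ^ 2 =
      2 - 2 * RCLike.re (starRingEnd ℂ (x : ℂ) * (circleMap g z : Circle)) := by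
    intro z
    rw [circle_dist_eq_norm, ← Complex.normSq_eq_norm_sq, Complex.normSq_sub, Circle.normSq_coe,
      Circle.normSq_coe, mul_comm (starRingEnd ℂ (x : ℂ))]
    norm_num
  simp only [h1]
  rw [integral_sub (integrable_const _) ((hi.const_mul _).re.const_mul 2), integral_const_mul,
    integral_re (hi.const_mul _), integral_const_mul, integral_coe_circleMap]
  simp

/-- Pointwise Chebyshev bound: continuity controls f near x, and away from x boundedness is absorbed
by the square distance. It turns mean square convergence into weak* convergence. -/
theorem exists_abs_sub_le_add_sq_dist {X : Type*} [PseudoMetricSpace X] [CompactSpace X]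
    {f : X → ℝ} (hf : Continuous f) (x : X) {ε : ℝ} (hε : 0 < ε) :
    ∃ C, 0 ≤ C ∧ ∀ z, |f z - f x| ≤ ε + C * dist z x ^ 2 := by
  obtain ⟨δ, hδ, hfδ⟩ := Metric.continuousAt_iff.1 hf.continuousAt ε hε
  obtain ⟨B, hB⟩ := isCompact_univ.exists_bound_of_continuousOn
    (f := fun z => f z - f x) (by fun_prop)
  have hB0 : 0 ≤ B := (norm_nonneg _).trans (hB x (mem_univ x))
  refine ⟨B / δ ^ 2, by positivity, fun z => ?_⟩
  rcases lt_or_ge (dist z x) δ with h | h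
  · have h1 := hfδ h
    rw [Real.dist_eq] at h1
    have : 0 ≤ B / δ ^ 2 * dist z x ^ 2 := by positivity
    linarith
  · have h1 : B ≤ B / δ ^ 2 * dist z x ^ 2 := by
      rw [div_mul_eq_mul_div, le_div_iff₀ (by positivity)]
      gcongr
    have h2 := hB z (mem_univ z)
    rw [Real.norm_eq_abs] at h2
    linarith

theorem represents_of_tendsto_center {G : ℕ → discMobius} {x : Circle}
    (h : Tendsto (fun n => center (G n)) atTop (𝓝 (x : ℂ))) : Represents G x := by
  intro f hf
  rw [integral_dirac]
  have hd : Tendsto (fun n => ∫ z, dist (circleMap (G n) z) x ^ 2 ∂uniformMeasure) atTop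
      (𝓝 0) := by
    simp only [integral_sq_dist_circleMap]
    have hx : 2 - 2 * (starRingEnd ℂ (x : ℂ) * x).re = 0 := by
      rw [mul_comm (starRingEnd ℂ (x : ℂ)), Complex.mul_conj, Circle.normSq_coe]; simp
    rw [← hx]
    exact ((Complex.continuous_re.tendsto _).comp (h.const_mul _)).const_mul 2 |>.const_sub 2
  rw [Metric.tendsto_nhds]
  intro ε hε
  obtain ⟨C, hC, hfC⟩ := exists_abs_sub_le_add_sq_dist hf x (half_pos hε)
  have hd2 : Tendsto (fun n => ε / 2 + C * ∫ z, dist (circleMap (G n) z) x ^ 2 ∂uniformMeasure)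
      atTop (𝓝 (ε / 2 + C * 0)) := (hd.const_mul C).const_add _
  filter_upwards [hd2.eventually (gt_mem_nhds (show ε / 2 + C * 0 < ε by linarith))] with n hn
  refine lt_of_le_of_lt ?_ hn
  have hG := continuous_circleMap (G n)
  have hint : ∀ φ : Circle → ℝ, Continuous φ → Integrable φ uniformMeasure := fun φ hφ =>
    hφ.integrable_of_hasCompactSupport (HasCompactSupport.of_compactSpace _)
  have hfG : Continuous fun z => f (circleMap (G n) z) := hf.comp hG
  have hdG : Continuous fun z => dist (circleMap (G n) z) x ^ 2 := by fun_prop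
  rw [integral_map hG.measurable.aemeasurable hf.aestronglyMeasurable_of_compactSpace,
    Real.dist_eq]
  have e1 : ∫ z, f (circleMap (G n) z) ∂uniformMeasure - f x =
      ∫ z, (f (circleMap (G n) z) - f x) ∂uniformMeasure := by
    rw [integral_sub (hint _ hfG) (integrable_const _)]; simp
  have e2 : ε / 2 + C * ∫ z, dist (circleMap (G n) z) x ^ 2 ∂uniformMeasure =
      ∫ z, (ε / 2 + C * dist (circleMap (G n) z) x ^ 2) ∂uniformMeasure := by
    rw [integral_add (integrable_const _) ((hint _ hdG).const_mul C), integral_const_mul]; simp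
  rw [e1, e2]
  refine (abs_integral_le_integral_abs).trans (integral_mono ?_ ?_ fun z => hfC _)
  · exact hint _ (by fun_prop)
  · exact hint _ (by fun_prop)

/-! ### Refined sets of prefixes -/

variable {A : Type*}

theorem wordPrefix_succ (w : ℕ → A) (n : ℕ) :
    wordPrefix w (n + 1) = wordPrefix w n ++ [w n] := by
  rw [wordPrefix, List.ofFn_succ_last]
  rfl

theorem wordPrefix_succ' (w : ℕ → A) (n : ℕ) :
    wordPrefix w (n + 1) = w 0 :: wordPrefix (fun i => w (i + 1)) n := by
  rw [wordPrefix, List.ofFn_succ]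
  rfl

theorem wordMap_append (F : A → discMobius) (u v : List A) :
    wordMap F (u ++ v) = wordMap F u * wordMap F v := by
  simp [wordMap]

theorem wordMap_cons (F : A → discMobius) (a : A) (u : List A) :
    wordMap F (a :: u) = F a * wordMap F u := by
  simp [wordMap]

@[simp] theorem wordMap_singleton (F : A → discMobius) (a : A) : wordMap F [a] = F a := by
  simp [wordMap]

@[simp] theorem wordMap_nil (F : A → discMobius) : wordMap F [] = 1 := by
  simp [wordMap]

theorem wordMap_wordPrefix_succ (F : A → discMobius) (w : ℕ → A) (n : ℕ) :
    wordMap F (wordPrefix w (n + 1)) = wordMap F (wordPrefix w n) * F (w n) := by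
  rw [wordPrefix_succ, wordMap_append, wordMap_singleton]

@[simp] theorem refinedSet_nil (F : A → discMobius) (W : A → Set Circle) :
    refinedSet F W [] = univ := by
  rw [refinedSet]
  exact iInter_eq_univ.2 fun i => i.elim0

theorem refinedSet_append_singleton (F : A → discMobius) (W : A → Set Circle) (u : List A)
    (a : A) :
    refinedSet F W (u ++ [a]) = refinedSet F W u ∩ circleMap (wordMap F u)⁻¹ ⁻¹' W a := by
  ext z
  simp only [refinedSet, mem_iInter, image_circleMap, mem_inter_iff]
  constructor
  · intro h
    refine ⟨fun i => ?_, ?_⟩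
    · have hi := h ⟨i, by simp⟩
      simpa [List.take_append_of_le_length i.2.le] using hi
    · simpa using h ⟨u.length, by simp⟩
  · rintro ⟨h1, h2⟩ ⟨i, hi⟩
    rw [List.length_append, List.length_singleton] at hi
    rcases (Nat.lt_succ_iff.1 hi).lt_or_eq with h | rfl
    · simpa [List.take_append_of_le_length h.le, List.getElem_append_left h] using h1 ⟨i, h⟩
    · simpa using h2

theorem mem_refinedSet_wordPrefix {F : A → discMobius} {W : A → Set Circle} {w : ℕ → A} {n : ℕ}
    {z : Circle} : z ∈ refinedSet F W (wordPrefix w n) ↔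
      ∀ i < n, circleMap (wordMap F (wordPrefix w i))⁻¹ z ∈ W (w i) := by
  induction n with
  | zero => simp [wordPrefix]
  | succ n ih =>
    rw [wordPrefix_succ, refinedSet_append_singleton, mem_inter_iff, ih, Nat.forall_lt_succ_right]
    rfl

theorem refinedSet_wordPrefix_anti (F : A → discMobius) (W : A → Set Circle) (w : ℕ → A) :
    Antitone fun n => refinedSet F W (wordPrefix w n) := fun _ _ hmn _ hz =>
  mem_refinedSet_wordPrefix.2 fun i hi => mem_refinedSet_wordPrefix.1 hz i (hi.trans_le hmn)

theorem isOpen_refinedSet (F : A → discMobius) {W : A → Set Circle} (hW : ∀ a, IsOpen (W a))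
    (u : List A) : IsOpen (refinedSet F W u) := by
  refine isOpen_iInter_of_finite fun i => ?_
  rw [image_circleMap]
  exact (hW _).preimage (continuous_circleMap _)

/-! ### Interval shifts -/

theorem mem_intervalShift_univ {F : A → discMobius} {W : A → Set Circle} {w : ℕ → A} :
    w ∈ intervalShift F W univ ↔ ∀ n, (refinedSet F W (wordPrefix w n)).Nonempty := by
  simp [intervalShift]

theorem wordPrefix_congr {w w' : ℕ → A} {n : ℕ} (h : ∀ i < n, w' i = w i) :
    wordPrefix w' n = wordPrefix w n := by
  rw [wordPrefix, wordPrefix]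
  congr 1
  ext i
  exact h i i.2

theorem eventually_wordPrefix_eq [TopologicalSpace A] [DiscreteTopology A] (w : ℕ → A) (n : ℕ) :
    ∀ᶠ w' in 𝓝 w, wordPrefix w' n = wordPrefix w n := by
  have h : ∀ᶠ w' in 𝓝 w, ∀ i ∈ Finset.range n, w' i = w i := by
    rw [Filter.eventually_all_finset]
    intro i _
    have hc : ContinuousAt (fun w' : ℕ → A => w' i) w := (continuous_apply i).continuousAt
    exact hc.eventually (p := fun a => a = w i) (mem_nhds_discrete.2 rfl)
  exact h.mono fun w' hw' => wordPrefix_congr fun i hi => hw' i (Finset.mem_range.2 hi)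

/-- A single prefix witnesses non-membership, hence closedness; F_{w_0}⁻¹ carries the refined set of
a prefix of w into that of the shifted, shorter prefix. -/
theorem isSubshift_intervalShift [TopologicalSpace A] [DiscreteTopology A] (F : A → discMobius)
    (W : A → Set Circle) : IsSubshift (intervalShift F W univ) := by
  constructor
  · rw [← isOpen_compl_iff, isOpen_iff_mem_nhds]
    intro w hw
    rw [mem_compl_iff, mem_intervalShift_univ, not_forall] at hw
    obtain ⟨n, hn⟩ := hw
    filter_upwards [eventually_wordPrefix_eq w n] with w' hw' h
    exact hn (hw' ▸ mem_intervalShift_univ.1 h n)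
  · intro w hw
    rw [mem_intervalShift_univ] at hw ⊢
    intro n
    obtain ⟨z, hz⟩ := hw (n + 1)
    refine ⟨circleMap (F (w 0))⁻¹ z, mem_refinedSet_wordPrefix.2 fun i hi => ?_⟩
    have h := mem_refinedSet_wordPrefix.1 hz (i + 1) (by omega)
    rwa [wordPrefix_succ', wordMap_cons, mul_inv_rev, circleMap_mul] at h

theorem exists_mem_iInter_closure {F : A → discMobius} {W : A → Set Circle} {w : ℕ → A}
    (hw : w ∈ intervalShift F W univ) :
    ∃ x, ∀ n, x ∈ closure (refinedSet F W (wordPrefix w n)) := by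
  rw [mem_intervalShift_univ] at hw
  obtain ⟨x, hx⟩ := IsCompact.nonempty_iInter_of_sequence_nonempty_isCompact_isClosed
    (fun n => closure (refinedSet F W (wordPrefix w n)))
    (fun n => closure_mono (refinedSet_wordPrefix_anti F W w n.le_succ))
    (fun n => (hw n).closure) isClosed_closure.isCompact (fun n => isClosed_closure)
  exact ⟨x, mem_iInter.1 hx⟩

/-- For a finite alphabet the cover condition says that the union of the W a is dense. Its
homeomorphic image is dense in the open refined set, and closure commutes with the finite union over
the next letter. -/
theorem exists_mem_closure_append [Finite A] (F : A → discMobius) {W : A → Set Circle}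
    (hW : ∀ a, IsOpen (W a)) (hcov : ⋃ a, closure (W a) = univ) {u : List A} {x : Circle}
    (hx : x ∈ closure (refinedSet F W u)) : ∃ a, x ∈ closure (refinedSet F W (u ++ [a])) := by
  let g := wordMap F u
  have hd : Dense (⋃ a, W a) := by
    rw [← closure_iUnion_of_finite] at hcov
    exact dense_iff_closure_eq.2 hcov
  have hop : IsOpenMap (circleMap g⁻¹) := fun S hS => by
    rw [image_circleMap]
    exact hS.preimage (continuous_circleMap _)
  have hd2 : Dense (circleMap g⁻¹ ⁻¹' ⋃ a, W a) := hd.preimage hop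
  have h := hd2.open_subset_closure_inter (isOpen_refinedSet F hW u)
  have h2 := closure_minimal h isClosed_closure hx
  rw [preimage_iUnion, inter_iUnion, closure_iUnion_of_finite, mem_iUnion] at h2
  obtain ⟨a, ha⟩ := h2
  exact ⟨a, by rwa [refinedSet_append_singleton]⟩

theorem exists_word_mem_iInter_closure [Finite A] (F : A → discMobius) {W : A → Set Circle}
    (hW : ∀ a, IsOpen (W a)) (hcov : ⋃ a, closure (W a) = univ) (x : Circle) :
    ∃ w : ℕ → A, ∀ n, x ∈ closure (refinedSet F W (wordPrefix w n)) := by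
  choose next hnext using fun u : {u : List A // x ∈ closure (refinedSet F W u)} =>
    exists_mem_closure_append F hW hcov u.2
  let U : ℕ → {u : List A // x ∈ closure (refinedSet F W u)} := fun n =>
    Nat.rec ⟨[], by simp⟩ (fun _ u => ⟨u.1 ++ [next u], hnext u⟩) n
  have hU : ∀ n, wordPrefix (fun n => next (U n)) n = (U n).1 := by
    intro n
    induction n with
    | zero => simp [wordPrefix, U]
    | succ n ih => rw [wordPrefix_succ, ih]
  exact ⟨fun n => next (U n), fun n => (hU n).symm ▸ (U n).2⟩

/-! ### Orbits along which the dilation tends to one -/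

/-- Off the ε-neighbourhood of the level set, φ has a compact image, which misses c and so misses a
neighbourhood of c. -/
theorem eventually_forall_eq_imp_exists_dist_lt {X : Type*} [PseudoMetricSpace X] [CompactSpace X]
    {φ : X → ℝ} (hφ : Continuous φ) (c : ℝ) {ε : ℝ} (hε : 0 < ε) :
    ∀ᶠ t in 𝓝 c, ∀ y, φ y = t → ∃ e, φ e = c ∧ dist y e < ε := by
  have hU : IsOpen {y | ∃ e, φ e = c ∧ dist y e < ε} := by
    have : {y | ∃ e, φ e = c ∧ dist y e < ε} = ⋃ e ∈ {e | φ e = c}, Metric.ball e ε := by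
      ext y; simp
    rw [this]
    exact isOpen_biUnion fun _ _ => Metric.isOpen_ball
  have hK : IsClosed (φ '' {y | ∃ e, φ e = c ∧ dist y e < ε}ᶜ) :=
    (hU.isClosed_compl.isCompact.image hφ).isClosed
  have hc : c ∈ (φ '' {y | ∃ e, φ e = c ∧ dist y e < ε}ᶜ)ᶜ := by
    rintro ⟨y, hy, rfl⟩
    exact hy ⟨y, rfl, by simpa using hε⟩
  filter_upwards [hK.isOpen_compl.mem_nhds hc] with t ht y hy
  by_contra h
  exact ht ⟨y, h, hy⟩

/-- This quantifier order also covers empty E, so nearest points can be chosen for every n at once.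
-/
theorem exists_nearest_of_finite {X : Type*} [PseudoMetricSpace X] {E : Set X} (hE : E.Finite)
    (y : X) : ∃ e, ∀ e' ∈ E, e ∈ E ∧ dist y e ≤ dist y e' := by
  rcases E.eq_empty_or_nonempty with rfl | hne
  · exact ⟨y, by simp⟩
  · obtain ⟨e, he, h⟩ := exists_min_image E (dist y) hE hne
    exact ⟨e, fun e' he' => ⟨he, h e' he'⟩⟩

/-- The orbit approaches the finite set E of points of dilation 1. Finiteness makes the nearest
points e n eventually an orbit too; the maps do not decrease the distance from y n to e n, yet it
tends to 0, so it vanishes. -/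
theorem eventually_derivModulus_eq_one [Finite A] {F : A → discMobius} {w : ℕ → A}
    {y : ℕ → Circle} (hne : ∀ n, center (F (w n)) ≠ 0)
    (hys : ∀ n, y (n + 1) = circleMap (F (w n))⁻¹ (y n))
    (hy : ∀ n, 1 ≤ derivModulus (F (w n))⁻¹ (y n))
    (hlim : Tendsto (fun n => derivModulus (F (w n))⁻¹ (y n)) atTop (𝓝 1)) :
    ∀ᶠ n in atTop, derivModulus (F (w n))⁻¹ (y n) = 1 := by
  let E : Set Circle := ⋃ a ∈ {a | center (F a) ≠ 0}, {e | derivModulus (F a)⁻¹ e = 1}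
  have hE : E.Finite := Set.Finite.biUnion (toFinite _) fun a ha => finite_derivModulus_eq_one ha
  choose e he using fun n => exists_nearest_of_finite (finite_derivModulus_eq_one (hne n)) (y n)
  have hnear : ∀ ε > 0, ∀ᶠ n in atTop,
      derivModulus (F (w n))⁻¹ (e n) = 1 ∧ dist (y n) (e n) < ε := by
    intro ε hε
    have h1 : ∀ᶠ t in 𝓝 (1 : ℝ), ∀ a, ∀ y, derivModulus (F a)⁻¹ y = t →
        ∃ e, derivModulus (F a)⁻¹ e = 1 ∧ dist y e < ε :=
      eventually_all.2 fun a =>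
        eventually_forall_eq_imp_exists_dist_lt (continuous_derivModulus _) 1 hε
    filter_upwards [hlim.eventually h1] with n hn
    obtain ⟨e', h2, h3⟩ := hn (w n) (y n) rfl
    obtain ⟨h4, h5⟩ := he n e' h2
    exact ⟨h4, h5.trans_lt h3⟩
  have he1 : ∀ᶠ n in atTop, derivModulus (F (w n))⁻¹ (e n) = 1 :=
    (hnear 1 one_pos).mono fun _ h => h.1
  have hd : Tendsto (fun n => dist (y n) (e n)) atTop (𝓝 0) := by
    rw [Metric.tendsto_nhds]
    intro ε hε
    filter_upwards [hnear ε hε] with n hn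
    rw [Real.dist_0_eq_abs, abs_of_nonneg dist_nonneg]
    exact hn.2
  have hsq : ∀ n, derivModulus (F (w n))⁻¹ (e n) = 1 →
      dist (y (n + 1)) (circleMap (F (w n))⁻¹ (e n)) ^ 2 =
        derivModulus (F (w n))⁻¹ (y n) * dist (y n) (e n) ^ 2 := by
    intro n hn
    rw [hys, sq_dist_circleMap, hn, mul_one]
  have hd1 : Tendsto (fun n => dist (y (n + 1)) (circleMap (F (w n))⁻¹ (e n))) atTop (𝓝 0) := by
    have h := (hlim.mul (hd.pow 2)).sqrt
    simp only [ne_eq, OfNat.ofNat_ne_zero, not_false_eq_true, zero_pow, mul_zero,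
      Real.sqrt_zero] at h
    refine h.congr' ?_
    filter_upwards [he1] with n hn
    rw [← hsq n hn, Real.sqrt_sq dist_nonneg]
  have hd2 : Tendsto (fun n => dist (circleMap (F (w n))⁻¹ (e n)) (e (n + 1))) atTop (𝓝 0) := by
    have h := hd1.add (hd.comp (tendsto_add_atTop_nat 1))
    rw [add_zero] at h
    exact squeeze_zero (fun _ => dist_nonneg) (fun n => dist_triangle_left _ _ _) h
  -- Only finitely many distances between E and its images occur, so a small enough one is zero.
  have hsep : ∀ᶠ t in 𝓝 (0 : ℝ), ∀ a, ∀ e ∈ E, ∀ e' ∈ E,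
      dist (circleMap (F a)⁻¹ e) e' = t → circleMap (F a)⁻¹ e = e' := by
    refine eventually_all.2 fun a => (eventually_all_finite hE).2 fun e _ =>
      (eventually_all_finite hE).2 fun e' _ => ?_
    by_cases h : circleMap (F a)⁻¹ e = e'
    · exact Eventually.of_forall fun _ _ => h
    · filter_upwards [gt_mem_nhds (dist_pos.2 h)] with t ht ht'
      exact absurd ht' ht.ne'
  have hstep : ∀ᶠ n in atTop, circleMap (F (w n))⁻¹ (e n) = e (n + 1) := by
    filter_upwards [hd2.eventually hsep, he1, (tendsto_add_atTop_nat 1).eventually he1]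
      with n h1 h2 h3
    refine h1 (w n) (e n) ?_ (e (n + 1)) ?_ rfl
    · exact mem_biUnion (hne n) h2
    · exact mem_biUnion (hne (n + 1)) h3
  obtain ⟨N, hN⟩ := eventually_atTop.1 (hstep.and he1)
  have hmono : ∀ n ≥ N, dist (y n) (e n) ≤ dist (y (n + 1)) (e (n + 1)) := by
    intro n hn
    obtain ⟨h1, h2⟩ := hN n hn
    have h := hsq n h2
    rw [h1] at h
    rw [← sq_le_sq₀ dist_nonneg dist_nonneg, h]
    exact le_mul_of_one_le_left (sq_nonneg _) (hy n)
  filter_upwards [eventually_ge_atTop N] with n hn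
  have h1 : dist (y n) (e n) ≤ 0 := by
    refine ge_of_tendsto hd ?_
    filter_upwards [eventually_ge_atTop n] with m hm
    induction m, hm using Nat.le_induction with
    | base => exact le_rfl
    | succ m hm ih => exact ih.trans (hmono m (hn.trans hm))
  rw [dist_le_zero.1 h1]
  exact (hN n hn).2

/-! ### The half-plane model with the point `x` at infinity -/

/-- The Cayley transformation mapping the disc to the right half-plane and `x` to infinity. -/
noncomputable def cayley (x c : ℂ) : ℂ := (x + c) / (x - c)

theorem norm_cayley_sub {x c c' : ℂ} (hx : ‖x‖ = 1) (hc : x - c ≠ 0) (hc' : x - c' ≠ 0) :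
    ‖cayley x c - cayley x c'‖ * (‖x - c‖ * ‖x - c'‖) = 2 * ‖c - c'‖ := by
  have h : (cayley x c - cayley x c') * ((x - c) * (x - c')) = 2 * x * (c - c') := by
    rw [cayley, cayley]
    field_simp
    ring
  have h2 := congrArg norm h
  simpa [hx] using h2

/-- Converts size in the half-plane into closeness to x, in both directions. -/
theorem norm_cayley_add_one {x c : ℂ} (hx : ‖x‖ = 1) (hc : x - c ≠ 0) :
    ‖cayley x c + 1‖ * ‖x - c‖ = 2 := by
  have h : (cayley x c + 1) * (x - c) = 2 * x := by
    rw [cayley]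
    field_simp
    ring
  have h2 := congrArg norm h
  simpa [hx] using h2

theorem re_cayley {x c : ℂ} (hx : ‖x‖ = 1) :
    (cayley x c).re = (1 - ‖c‖ ^ 2) / ‖x - c‖ ^ 2 := by
  have hx2 : Complex.normSq x = 1 := by rw [Complex.normSq_eq_norm_sq, hx, one_pow]
  rw [cayley, Complex.div_re, ← Complex.normSq_eq_norm_sq, ← Complex.normSq_eq_norm_sq, ← add_div,
    ← hx2]
  congr 1
  simp only [Complex.normSq_apply, Complex.add_re, Complex.add_im, Complex.sub_re, Complex.sub_im]
  ring

/-- The real part is the Poisson kernel, so horocycles at x become vertical lines. -/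
theorem re_cayley_center (g : discMobius) (x : Circle) :
    (cayley x (center g)).re = derivModulus g⁻¹ x := by
  have h := norm_ne_zero_iff.2 (coe_sub_center_ne_zero g x)
  rw [re_cayley x.norm_coe, ← derivModulus_inv_mul g x]
  field_simp

theorem re_cayley_circle (x z : Circle) : (cayley x z).re = 0 := by
  rw [re_cayley x.norm_coe, Circle.norm_coe]; simp

/-- With the dilation at x fixed, the one at z grows exactly as the centre approaches z in the
half-plane. -/
theorem derivModulus_inv_mul_sq_norm_cayley_sub (g : discMobius) {x z : Circle} (hz : x ≠ z) :
    derivModulus g⁻¹ z * (‖cayley x z - cayley x (center g)‖ * ‖(x : ℂ) - z‖) ^ 2 =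
      4 * derivModulus g⁻¹ x := by
  have hxz : (x : ℂ) - z ≠ 0 := sub_ne_zero.2 fun h => hz (Circle.ext h)
  have hc := coe_sub_center_ne_zero g x
  have hn := norm_pos_iff.2 hc
  have h1 := norm_cayley_sub x.norm_coe hxz hc
  have h2 := derivModulus_inv_mul g x
  have h3 := derivModulus_inv_mul g z
  have h4 : (‖cayley x z - cayley x (center g)‖ * ‖(x : ℂ) - z‖) ^ 2 * ‖(x : ℂ) - center g‖ ^ 2 =
      4 * ‖(z : ℂ) - center g‖ ^ 2 := by
    rw [← mul_pow, mul_assoc, h1]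
    ring
  have h5 : ‖(x : ℂ) - center g‖ ^ 2 ≠ 0 := by positivity
  apply mul_right_cancel₀ h5
  linear_combination derivModulus g⁻¹ z * h4 + 4 * h3 - 4 * h2

/-- The invariance of hyperbolic distance, read in the half-plane. -/
theorem sq_norm_cayley_center_mul_sub (g h : discMobius) (x : Circle) :
    ‖cayley x (center (g * h)) - cayley x (center g)‖ ^ 2 * (1 - ‖center h‖ ^ 2) =
      4 * derivModulus (g * h)⁻¹ x * derivModulus g⁻¹ x * ‖center h‖ ^ 2 := by
  have hc := coe_sub_center_ne_zero g x
  have hc' := coe_sub_center_ne_zero (g * h) x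
  have h1 := norm_cayley_sub x.norm_coe hc' hc
  have h2 := derivModulus_inv_mul g x
  have h3 := derivModulus_inv_mul (g * h) x
  have h4 := sq_norm_center_mul_sub g h
  have h5 := norm_pos_iff.2 hc
  have h6 := norm_pos_iff.2 hc'
  have h7 : (‖(x : ℂ) - center (g * h)‖ * ‖(x : ℂ) - center g‖) ^ 2 ≠ 0 := by positivity
  apply mul_right_cancel₀ h7
  have h8 := congrArg (fun t => t ^ 2 * (1 - ‖center h‖ ^ 2)) h1
  beta_reduce at h8
  rw [← h2, ← h3] at h4
  linear_combination h8 + 4 * h4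

/-- Steps of size at least κ that never change sign give linear growth; the descending case is the
negative of the ascending one. -/
theorem tendsto_abs_atTop_of_steps {s : ℕ → ℝ} {κ : ℝ} (hκ : 0 < κ)
    (hstep : ∀ n, κ ≤ |s (n + 1) - s n|)
    (hsign : ∀ n, 0 ≤ (s (n + 1) - s n) * (s (n + 2) - s (n + 1))) :
    Tendsto (fun n => |s n|) atTop atTop := by
  have main : ∀ s : ℕ → ℝ, (∀ n, κ ≤ |s (n + 1) - s n|) →
      (∀ n, 0 ≤ (s (n + 1) - s n) * (s (n + 2) - s (n + 1))) → 0 ≤ s 1 - s 0 →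
      Tendsto (fun n => |s n|) atTop atTop := by
    intro s hstep hsign h0
    have hpos : ∀ n, κ ≤ s (n + 1) - s n := by
      intro n
      have hge : 0 ≤ s (n + 1) - s n := by
        induction n with
        | zero => exact h0
        | succ n ih =>
          have h1 := hstep n
          rw [abs_of_nonneg ih] at h1
          exact nonneg_of_mul_nonneg_right (hsign n) (by linarith)
      simpa [abs_of_nonneg hge] using hstep n
    have hlin : ∀ n : ℕ, s 0 + n * κ ≤ s n := by
      intro n
      induction n with
      | zero => simp
      | succ n ih => push_cast; linarith [hpos n]
    refine tendsto_atTop_mono (fun n => (hlin n).trans (le_abs_self _)) ?_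
    exact tendsto_atTop_add_const_left _ _ (tendsto_natCast_atTop_atTop.atTop_mul_const hκ)
  rcases le_total 0 (s 1 - s 0) with h | h
  · exact main s hstep hsign h
  · have := main (fun n => -s n) (fun n => ?_) (fun n => ?_) (by linarith)
    · simpa using this
    · rw [neg_sub_neg, abs_sub_comm]; exact hstep n
    · linarith [hsign n]

/-! ### Convergence -/

theorem tendsto_center_of_mem_closure_refinedSet [Finite A] {F : A → discMobius} {w : ℕ → A}
    {x : Circle} (hx : ∀ n, x ∈ closure
      (refinedSet F (fun a => expansionInterval (F a)⁻¹) (wordPrefix w n))) :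
    Tendsto (fun n => center (wordMap F (wordPrefix w n))) atTop (𝓝 (x : ℂ)) := by
  set V : A → Set Circle := fun a => expansionInterval (F a)⁻¹
  set G : ℕ → discMobius := fun n => wordMap F (wordPrefix w n)
  have hGs : ∀ n, G (n + 1) = G n * F (w n) := wordMap_wordPrefix_succ F w
  have hmem : ∀ {n z}, z ∈ refinedSet F V (wordPrefix w n) →
      ∀ i < n, 1 < derivModulus (F (w i))⁻¹ (circleMap (G i)⁻¹ z) := fun hz i hi =>
    mem_refinedSet_wordPrefix.1 hz i hi
  have hchain : ∀ n z, derivModulus (G (n + 1))⁻¹ z =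
      derivModulus (F (w n))⁻¹ (circleMap (G n)⁻¹ z) * derivModulus (G n)⁻¹ z := fun n z => by
    rw [hGs, mul_inv_rev, derivModulus_mul]
  have hne : ∀ n, center (F (w n)) ≠ 0 := fun n => by
    obtain ⟨z, hz⟩ := closure_nonempty_iff.1 ⟨x, hx (n + 1)⟩
    exact center_ne_zero_of_nonempty ⟨_, hmem hz n n.lt_succ_self⟩
  have hy : ∀ n, 1 ≤ derivModulus (F (w n))⁻¹ (circleMap (G n)⁻¹ x) := fun n => by
    have hcl : IsClosed {z | 1 ≤ derivModulus (F (w n))⁻¹ (circleMap (G n)⁻¹ z)} :=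
      isClosed_le continuous_const ((continuous_derivModulus _).comp (continuous_circleMap _))
    exact closure_minimal (fun z hz => (hmem hz n n.lt_succ_self).le) hcl (hx (n + 1))
  have hmono : Monotone fun n => derivModulus (G n)⁻¹ x := monotone_nat_of_le_succ fun n => by
    rw [hchain]
    exact le_mul_of_one_le_left (derivModulus_pos _ _).le (hy n)
  rcases tendsto_atTop_of_monotone hmono with h | ⟨M, hM⟩
  · exact tendsto_center_of_derivModulus_atTop h
  have hM0 : 0 < M := (derivModulus_pos (G 0)⁻¹ x).trans_le (hmono.ge_of_tendsto hM 0)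
  have hlim : Tendsto (fun n => derivModulus (F (w n))⁻¹ (circleMap (G n)⁻¹ x)) atTop (𝓝 1) := by
    have h := (hM.comp (tendsto_add_atTop_nat 1)).div hM hM0.ne'
    rw [div_self hM0.ne'] at h
    refine h.congr fun n => ?_
    simp only [Pi.div_apply, Function.comp_apply]
    rw [hchain, mul_div_cancel_right₀ _ (derivModulus_pos _ _).ne']
  have hone := eventually_derivModulus_eq_one (y := fun n => circleMap (G n)⁻¹ x) hne
    (fun n => by rw [hGs, mul_inv_rev, circleMap_mul]) hy hlim
  obtain ⟨N, hN⟩ := eventually_atTop.1 hone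
  have hpM : ∀ n ≥ N, derivModulus (G n)⁻¹ x = M := by
    have hconst : ∀ n ≥ N, derivModulus (G n)⁻¹ x = derivModulus (G N)⁻¹ x := by
      intro n hn
      induction n, hn using Nat.le_induction with
      | base => rfl
      | succ n hn ih => rw [hchain, hN n hn, one_mul, ih]
    have hlimN := tendsto_nhds_unique hM
      (tendsto_const_nhds.congr' ((eventually_ge_atTop N).mono fun n hn => (hconst n hn).symm))
    exact fun n hn => (hconst n hn).trans hlimN.symm
  set ζ : ℕ → ℂ := fun n => cayley x (center (G n))
  have hre : ∀ n ≥ N, (ζ n).re = M := fun n hn => (re_cayley_center (G n) x).trans (hpM n hn)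
  have hstep : ∃ κ > 0, ∀ n ≥ N, κ ≤ |(ζ (n + 1)).im - (ζ n).im| := by
    have hδ : ∀ᶠ δ : ℝ in 𝓝[>] 0, ∀ a, center (F a) ≠ 0 → δ < ‖center (F a)‖ := by
      refine eventually_all.2 fun a => nhdsWithin_le_nhds ?_
      by_cases ha : center (F a) = 0
      · simp [ha]
      · filter_upwards [gt_mem_nhds (norm_pos_iff.2 ha)] with δ hδ _ using hδ
    obtain ⟨δ, hδ, hδ0⟩ := (hδ.and self_mem_nhdsWithin).exists
    have hδ0 : 0 < δ := hδ0
    -- On the line Re = M the step Δ satisfies Δ²(1 - |h|²) = 4M²|h|² with h the centre of the next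
    -- letter's map, and |h| > δ.
    refine ⟨2 * M * δ, by positivity, fun n hn => ?_⟩
    have h1 := sq_norm_cayley_center_mul_sub (G n) (F (w n)) x
    rw [← hGs, hpM n hn, hpM (n + 1) (by omega), ← Complex.normSq_eq_norm_sq,
      Complex.normSq_apply] at h1
    have h2 : (cayley x (center (G (n + 1))) - cayley x (center (G n))).re = 0 := by
      rw [Complex.sub_re]
      exact sub_eq_zero.2 ((hre (n + 1) (by omega)).trans (hre n hn).symm)
    rw [h2, Complex.sub_im] at h1
    change (0 * 0 + ((ζ (n + 1)).im - (ζ n).im) * ((ζ (n + 1)).im - (ζ n).im)) * _ = _ at h1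
    have h3 := hδ (w n) (hne n)
    have h4 : δ ^ 2 ≤ ‖center (F (w n))‖ ^ 2 := by gcongr
    have h5 : ((2 * M) * δ) ^ 2 ≤ ((ζ (n + 1)).im - (ζ n).im) ^ 2 := by
      have h6 : (2 * M) ^ 2 * δ ^ 2 ≤ (2 * M) ^ 2 * ‖center (F (w n))‖ ^ 2 := by gcongr
      have h7 : 0 ≤ ((ζ (n + 1)).im - (ζ n).im) ^ 2 * ‖center (F (w n))‖ ^ 2 := by positivity
      linarith
    exact (abs_of_pos (by positivity : 0 < 2 * M * δ)).symm.trans_le (sq_le_sq.1 h5)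
  have hsign : ∀ n ≥ N,
      0 ≤ ((ζ (n + 1)).im - (ζ n).im) * ((ζ (n + 2)).im - (ζ (n + 1)).im) := by
    intro n hn
    by_contra! hlt
    set s₀ := (ζ n).im
    set s₁ := (ζ (n + 1)).im
    set s₂ := (ζ (n + 2)).im
    set B := |s₀| + |s₁| + |s₂|
    have hB : 0 ≤ B := by positivity
    -- B bounds the image of z on the imaginary axis, and |x - z| = 2/|`cayley x z` + 1|; then x
    -- cannot lie in the closure.
    have hsub : refinedSet F V (wordPrefix w (n + 2)) ⊆ {z | 2 / (1 + B) ≤ dist x z} := by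
      intro z hz
      have hxz : x ≠ z := by
        -- At x the dilation at step n is exactly 1, whereas the refined set demands more than 1.
        rintro rfl
        exact (hmem hz n (by omega)).ne' (hN n hn)
      have hxz' : (x : ℂ) - z ≠ 0 := sub_ne_zero.2 fun h => hxz (Circle.ext h)
      -- Expansion at z means that each step brings the centre closer to z in the half-plane.
      have hcmp : ∀ m ≥ N, m < n + 2 →
          ((cayley x z).im - (ζ (m + 1)).im) ^ 2 < ((cayley x z).im - (ζ m).im) ^ 2 := by
        intro m hm hmn
        have h1 := derivModulus_inv_mul_sq_norm_cayley_sub (G m) hxz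
        have h2 := derivModulus_inv_mul_sq_norm_cayley_sub (G (m + 1)) hxz
        have h3 : derivModulus (G m)⁻¹ z < derivModulus (G (m + 1))⁻¹ z := by
          rw [hchain]
          exact lt_mul_of_one_lt_left (derivModulus_pos _ _) (hmem hz m hmn)
        have h4 : ∀ k ≥ N, ‖cayley x z - cayley x (center (G k))‖ ^ 2 =
            M ^ 2 + ((cayley x z).im - (ζ k).im) ^ 2 := by
          intro k hk
          rw [← Complex.normSq_eq_norm_sq, Complex.normSq_apply, Complex.sub_re, Complex.sub_im,
            re_cayley_circle]
          change (0 - (ζ k).re) * (0 - (ζ k).re) + _ = _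
          rw [hre k hk]
          ring
        rw [hpM m hm, mul_pow, h4 m hm] at h1
        rw [hpM (m + 1) (by omega), mul_pow, h4 (m + 1) (by omega), ← h1] at h2
        by_contra! hge
        have hp := derivModulus_pos (G m)⁻¹ z
        have hn2 : 0 < ‖(x : ℂ) - z‖ ^ 2 := pow_pos (norm_pos_iff.2 hxz') 2
        refine lt_irrefl (derivModulus (G m)⁻¹ z *
          ((M ^ 2 + ((cayley x z).im - (ζ m).im) ^ 2) * ‖(x : ℂ) - z‖ ^ 2)) ?_
        calc _ ≤ derivModulus (G m)⁻¹ z *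
              ((M ^ 2 + ((cayley x z).im - (ζ (m + 1)).im) ^ 2) * ‖(x : ℂ) - z‖ ^ 2) := by gcongr
          _ < derivModulus (G (m + 1))⁻¹ z *
              ((M ^ 2 + ((cayley x z).im - (ζ (m + 1)).im) ^ 2) * ‖(x : ℂ) - z‖ ^ 2) := by gcongr
          _ = _ := h2
      have c1 := hcmp n hn (by omega)
      have c2 := hcmp (n + 1) (by omega) (by omega)
      change ((cayley x z).im - s₁) ^ 2 < ((cayley x z).im - s₀) ^ 2 at c1
      change ((cayley x z).im - s₂) ^ 2 < ((cayley x z).im - s₁) ^ 2 at c2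
      have hτ : |(cayley x z).im| ≤ B := by
        set τ := (cayley x z).im
        have a0 := abs_le.1 (le_refl |s₀|)
        have a1 := abs_le.1 (le_refl |s₁|)
        have a2 := abs_le.1 (le_refl |s₂|)
        have d1 : 0 < (s₁ - s₀) * (2 * τ - s₀ - s₁) := by linarith
        have d2 : 0 < (s₂ - s₁) * (2 * τ - s₁ - s₂) := by linarith
        have b0 := abs_nonneg s₀
        have b1 := abs_nonneg s₁
        have b2 := abs_nonneg s₂
        -- After a reversal, τ is trapped between the midpoints of s₀, s₁ and of s₁, s₂.
        rcases mul_neg_iff.1 hlt with ⟨e1, e2⟩ | ⟨e1, e2⟩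
        · have f1 := pos_of_mul_pos_right d1 e1.le
          have f2 := neg_of_mul_pos_right d2 e2.le
          rw [abs_le]; constructor <;> simp only [B] <;> linarith
        · have f1 := neg_of_mul_pos_right d1 e1.le
          have f2 := pos_of_mul_pos_right d2 e2.le
          rw [abs_le]; constructor <;> simp only [B] <;> linarith
      have h1 := norm_cayley_add_one x.norm_coe hxz'
      have h2 : ‖cayley x z + 1‖ ≤ 1 + B := by
        refine (norm_add_le _ _).trans ?_
        have := Complex.norm_le_abs_re_add_abs_im (cayley x z)
        rw [re_cayley_circle, abs_zero, zero_add] at this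
        rw [norm_one]
        linarith
      rw [mem_ofPred_eq, circle_dist_eq_norm, div_le_iff₀ (by positivity), ← h1, mul_comm]
      gcongr
    have hcl : IsClosed {z | 2 / (1 + B) ≤ dist x z} := isClosed_le (by fun_prop) (by fun_prop)
    have hxx : 2 / (1 + B) ≤ dist x x := closure_minimal hsub hcl (hx (n + 2))
    rw [dist_self] at hxx
    have : 0 < 2 / (1 + B) := by positivity
    linarith
  obtain ⟨κ, hκ, hκs⟩ := hstep
  have hinf := tendsto_abs_atTop_of_steps (s := fun n => (ζ (n + N)).im) hκ
    (fun n => by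
      have h := hκs (n + N) (by omega)
      rwa [show n + N + 1 = n + 1 + N by omega] at h)
    (fun n => by
      have h := hsign (n + N) (by omega)
      rwa [show n + N + 1 = n + 1 + N by omega, show n + N + 2 = n + 2 + N by omega] at h)
  rw [tendsto_add_atTop_iff_nat (f := fun n => |(ζ n).im|) N] at hinf
  rw [tendsto_iff_norm_sub_tendsto_zero]
  have hinv := (tendsto_inv_atTop_zero.comp hinf).const_mul 2
  rw [mul_zero] at hinv
  refine squeeze_zero' (Eventually.of_forall fun _ => norm_nonneg _) ?_ hinv
  filter_upwards [hinf.eventually_gt_atTop 0] with n hn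
  have h1 := norm_cayley_add_one x.norm_coe (coe_sub_center_ne_zero (G n) x)
  have h2 : |(ζ n).im| ≤ ‖cayley x (center (G n)) + 1‖ := by
    have := Complex.abs_im_le_norm (cayley x (center (G n)) + 1)
    simpa using this
  rw [Function.comp_apply, norm_sub_rev, ← div_eq_mul_inv, le_div_iff₀ hn, ← h1, mul_comm]
  gcongr

theorem phi_eq_of_mem_closure [Finite A] {F : A → discMobius} {w : ℕ → A} {x : Circle}
    (hx : ∀ n, x ∈ closure
      (refinedSet F (fun a => expansionInterval (F a)⁻¹) (wordPrefix w n))) : Phi F w = x :=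
  Phi_eq (represents_of_tendsto_center (tendsto_center_of_mem_closure_refinedSet hx))

theorem phi_mem_closure_refinedSet [Finite A] {F : A → discMobius} {w : ℕ → A}
    (hw : w ∈ intervalShift F (fun a => expansionInterval (F a)⁻¹) univ) (n : ℕ) :
    Phi F w ∈ closure
      (refinedSet F (fun a => expansionInterval (F a)⁻¹) (wordPrefix w n)) := by
  obtain ⟨x, hx⟩ := exists_mem_iInter_closure hw
  exact phi_eq_of_mem_closure hx ▸ hx n

theorem continuousOn_phi_intervalShift [Finite A] [TopologicalSpace A] [DiscreteTopology A]
    (F : A → discMobius) :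
    ContinuousOn (Phi F) (intervalShift F (fun a => expansionInterval (F a)⁻¹) univ) := by
  intro w hw
  set R := fun n => closure
    (refinedSet F (fun a => expansionInterval (F a)⁻¹) (wordPrefix w n))
  intro U hU
  obtain ⟨U', hU', hU'o, hwU'⟩ := mem_nhds_iff.1 hU
  -- The nested compact sets R n meet only in Φ(w), so one of them lies inside U'; words sharing
  -- that prefix have their values in the same set.
  obtain ⟨n, hn⟩ : ∃ n, R n ⊆ U' := by
    by_contra! hcon
    obtain ⟨x, hx⟩ := IsCompact.nonempty_iInter_of_sequence_nonempty_isCompact_isClosed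
      (fun n => R n ∩ U'ᶜ)
      (fun n => inter_subset_inter_left _
        (closure_mono (refinedSet_wordPrefix_anti F _ w n.le_succ)))
      (fun n => not_subset.1 (hcon n))
      (isClosed_closure.inter hU'o.isClosed_compl).isCompact
      (fun n => isClosed_closure.inter hU'o.isClosed_compl)
    rw [mem_iInter] at hx
    have h := phi_eq_of_mem_closure fun n => (hx n).1
    exact (hx 0).2 (h ▸ hwU')
  rw [mem_map]
  filter_upwards [nhdsWithin_le_nhds (eventually_wordPrefix_eq w n), self_mem_nhdsWithin]
    with w' hw' hmem
  refine hU' (hn ?_)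
  have h := phi_mem_closure_refinedSet hmem n
  rwa [hw'] at h

end MobiusNumber

open MobiusNumber in
theorem mainTheorem2 {A : Type*} [Finite A] [TopologicalSpace A] [DiscreteTopology A]
    (F : A → discMobius)
    (hV : IsIntervalAlmostCover fun a => expansionInterval (F a)⁻¹) :
    IsMobiusNumberSystem F
      (intervalShift F (fun a => expansionInterval (F a)⁻¹) univ) := by
  refine ⟨isSubshift_intervalShift F _, fun w hw => ?_, ?_, continuousOn_phi_intervalShift F⟩
  · obtain ⟨x, hx⟩ := exists_mem_iInter_closure hw
    exact ⟨x, represents_of_tendsto_center (tendsto_center_of_mem_closure_refinedSet hx)⟩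
  · refine eq_univ_of_forall fun x => ?_
    obtain ⟨w, hw⟩ := exists_word_mem_iInter_closure F
      (fun a => isOpen_expansionInterval (F a)⁻¹) hV.iUnion_closure x
    exact ⟨w, mem_intervalShift_univ.2 fun n => closure_nonempty_iff.1 ⟨x, hw n⟩,
      phi_eq_of_mem_closure hw⟩
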